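/- Let $M$ be an $n$-dimensional $C^\infty$ manifold and let $(M,L)$ be a Finsler manifold, i.e. $L=L(x,y)$ is a smooth positive function on the slit tangent bundle $TM\setminus 0$, positively homogeneous of degree $1$ in $y$, with positive definite fundamental tensor $g_{ij}=\dot\partial_i\dot\partial_j(\tfrac12 L^2)$, where $\partial_i=\partial/\partial x^i$ and $\dot\partial_i=\partial/\partial y^i$. Let $\sigma$ be a smooth function on $M$ and $\beta(x,y)=b_i(x)y^i$ a smooth 1-form on $M$ such that the $\beta$-conformal change $\overline L=e^{\sigma}L+\beta$ is again a Finsler metric function. Let $\Gamma^i_{jk}$ and $\overline\Gamma^i_{jk}$ be the horizontal coefficients of the Cartan connections of $(M,L)$ and $(M,\overline L)$: explicitly, with $\gamma^i_{jk}=\tfrac12 g^{il}(\partial_j g_{lk}+\partial_k g_{jl}-\partial_l g_{jk})$, $C^i_{jk}=\tfrac12 g^{il}\dot\partial_k g_{lj}$, $N^i_j=\gamma^i_{jk}y^k-C^i_{jk}\gamma^k_{rs}y^ry^s$ and $\delta_k=\partial_k-N^r_k\dot\partial_r$, one has $\Gamma^i_{jk}=\tfrac12 g^{il}(\delta_j g_{lk}+\delta_k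 g_{jl}-\delta_l g_{jk})$, and $N^i_j=y^k\Gamma^i_{jk}$. Put $D^i_{jk}=\overline\Gamma^i_{jk}-\Gamma^i_{jk}$ and $\sigma_i=\partial_i\sigma$. Consider the two assertions: (i) $b_i$ is (horizontally) parallel with respect to the Cartan connection of $(M,L)$, i.e. $b_{i|j}:=\delta_j b_i-b_r\Gamma^r_{ij}=0$ on $TM\setminus 0$; (ii) the difference tensor $D^i_{jk}$ vanishes identically on $TM\setminus 0$. Then: (a) if (i) and (ii) hold, then $\sigma$ is homothetic, i.e. $\sigma_i=0$ on $M$; (b) if $\sigma$ is homothetic, then (i) and (ii) are equivalent. -/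

import Mathlib

open scoped Manifold ContDiff

noncomputable section

namespace Finsler

/-! ### Calculus on functions `f (x, y)` of a position `x` and a supporting element `y` -/

/-- Coordinate `n`-space. -/
abbrev Coord (n : ℕ) := EuclideanSpace ℝ (Fin n)

variable {n : ℕ}

/-- The partial derivative `∂ᵢ f = ∂f/∂xⁱ`. -/
def dx (i : Fin n) (f : Coord n → Coord n → ℝ) : Coord n → Coord n → ℝ :=
  fun x y => fderiv ℝ (fun x' => f x' y) x (EuclideanSpace.single i 1)

/-- The partial derivative `∂̇ᵢ f = ∂f/∂yⁱ`. -/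
def dy (i : Fin n) (f : Coord n → Coord n → ℝ) : Coord n → Coord n → ℝ :=
  fun x y => fderiv ℝ (fun y' => f x y') y (EuclideanSpace.single i 1)

/-! ### Local objects of a Finsler function `F (x, y)` given in coordinates -/

/-- The energy `E = F² / 2`. -/
def energy (F : Coord n → Coord n → ℝ) : Coord n → Coord n → ℝ :=
  fun x y => F x y ^ 2 / 2

/-- The fundamental tensor `gᵢⱼ = ∂̇ᵢ ∂̇ⱼ E`. -/
def fund (F : Coord n → Coord n → ℝ) (i j : Fin n) : Coord n → Coord n → ℝ :=
  dy i (dy j (energy F))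

/-- The matrix `(gᵢⱼ)` at `(x, y)`. -/
def fundMatrix (F : Coord n → Coord n → ℝ) (x y : Coord n) : Matrix (Fin n) (Fin n) ℝ :=
  Matrix.of fun i j => fund F i j x y

/-- The inverse metric `gⁱʲ`. -/
def fundInv (F : Coord n → Coord n → ℝ) (i j : Fin n) : Coord n → Coord n → ℝ :=
  fun x y => (fundMatrix F x y)⁻¹ i j

/-- The Cartan tensor `Cᵢⱼₖ = (1/2) ∂̇ₖ gᵢⱼ`. -/
def cartanTensor (F : Coord n → Coord n → ℝ) (i j k : Fin n) : Coord n → Coord n → ℝ :=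
  fun x y => (1 / 2) * dy k (fund F i j) x y

/-- The torsion tensor `Cⁱⱼₖ = gⁱˡ Cₗⱼₖ`. -/
def cartanTorsion (F : Coord n → Coord n → ℝ) (i j k : Fin n) : Coord n → Coord n → ℝ :=
  fun x y => ∑ l, fundInv F i l x y * cartanTensor F l j k x y

/-- The formal Christoffel symbols `γⁱⱼₖ = (1/2) gⁱˡ (∂ⱼ gₗₖ + ∂ₖ gⱼₗ - ∂ₗ gⱼₖ)`. -/
def christoffel (F : Coord n → Coord n → ℝ) (i j k : Fin n) : Coord n → Coord n → ℝ :=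
  fun x y => (1 / 2) * ∑ l, fundInv F i l x y *
    (dx j (fund F l k) x y + dx k (fund F j l) x y - dx l (fund F j k) x y)

/-- The canonical (Cartan) nonlinear connection
`Nⁱⱼ = γⁱⱼₖ yᵏ - Cⁱⱼₖ γᵏᵣₛ yʳ yˢ`. Since `Cᵢⱼₖ yᵏ = 0`, this is `yᵏ Γⁱⱼₖ` for the
coefficients `Γⁱⱼₖ` of the Cartan connection below. -/
def nonlinearConn (F : Coord n → Coord n → ℝ) (i j : Fin n) : Coord n → Coord n → ℝ :=
  fun x y => ∑ k, christoffel F i j k x y * y k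
    - ∑ k, cartanTorsion F i j k x y * ∑ r, ∑ s, christoffel F k r s x y * y r * y s

/-- The horizontal derivative `δₖ f = ∂ₖ f - Nʳₖ ∂̇ᵣ f`. -/
def hDeriv (F : Coord n → Coord n → ℝ) (k : Fin n) (f : Coord n → Coord n → ℝ) :
    Coord n → Coord n → ℝ :=
  fun x y => dx k f x y - ∑ r, nonlinearConn F r k x y * dy r f x y

/-- The horizontal coefficients of the Cartan connection,
`Γⁱⱼₖ = (1/2) gⁱˡ (δⱼ gₗₖ + δₖ gⱼₗ - δₗ gⱼₖ)`. -/
def cartanConn (F : Coord n → Coord n → ℝ) (i j k : Fin n) : Coord n → Coord n → ℝ :=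
  fun x y => (1 / 2) * ∑ l, fundInv F i l x y *
    (hDeriv F j (fund F l k) x y + hDeriv F k (fund F j l) x y - hDeriv F l (fund F j k) x y)

/-- The horizontal covariant derivative `X_{i|k} = δₖ Xᵢ - Xᵣ Γʳᵢₖ` of a covariant vector
`Xᵢ (x, y)` with respect to the Cartan connection of `F`. -/
def hCovDeriv (F : Coord n → Coord n → ℝ) (X : Fin n → Coord n → Coord n → ℝ) (i k : Fin n) :
    Coord n → Coord n → ℝ :=
  fun x y => hDeriv F k (X i) x y - ∑ r, X r x y * cartanConn F r i k x y

/-! ### Finsler manifolds and the change `L ↦ e^σ L + β` -/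

variable {M : Type*} [TopologicalSpace M] [ChartedSpace (Coord n) M]

/-- The expression of `F : TM → ℝ` in the coordinates `(xⁱ, yⁱ)` induced by a chart `φ`:
`(x, y) ↦ F (yⁱ ∂/∂xⁱ at φ⁻¹ x)`. -/
def localExpr (φ : OpenPartialHomeomorph M (Coord n)) (F : TangentBundle (𝓡 n) M → ℝ) :
    Coord n → Coord n → ℝ :=
  fun x y => F ⟨φ.symm x, mfderiv (𝓡 n) (𝓡 n) φ.symm x y⟩

/-- `L` is a Finsler metric function on `M`: smooth on the slit tangent bundle, positively
homogeneous of degree one in `y`, positive for `y ≠ 0`, with positive definite `gᵢⱼ`. -/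
structure IsFinslerMetric [IsManifold (𝓡 n) ∞ M] (L : TangentBundle (𝓡 n) M → ℝ) : Prop where
  smooth : ContMDiffOn (𝓡 n).tangent 𝓘(ℝ, ℝ) ∞ L {v | v.2 ≠ 0}
  homogeneous : ∀ (p : M) (y : TangentSpace (𝓡 n) p) (c : ℝ), 0 < c →
    L ⟨p, c • y⟩ = c * L ⟨p, y⟩
  pos : ∀ (p : M) (y : TangentSpace (𝓡 n) p), y ≠ 0 → 0 < L ⟨p, y⟩
  posDef : ∀ φ ∈ IsManifold.maximalAtlas (𝓡 n) ∞ M, ∀ x ∈ φ.target, ∀ y : Coord n, y ≠ 0 →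
    (fundMatrix (localExpr φ L) x y).PosDef

/-- A 1-form on `M`, seen as the function `β (x, y) = bᵢ(x) yⁱ` on `TM`. -/
def formFun (b : (p : M) → TangentSpace (𝓡 n) p →ₗ[ℝ] ℝ) : TangentBundle (𝓡 n) M → ℝ :=
  fun v => b v.1 v.2

/-- The 1-form `b` is smooth, i.e. `β (x, y) = bᵢ(x) yⁱ` is a smooth function on `TM`. -/
def IsSmoothForm [IsManifold (𝓡 n) ∞ M] (b : (p : M) → TangentSpace (𝓡 n) p →ₗ[ℝ] ℝ) : Prop :=
  ContMDiff (𝓡 n).tangent 𝓘(ℝ, ℝ) ∞ (formFun b)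

/-- The components `bᵢ(x) = β (x, ∂/∂xⁱ)` in a chart, as functions of `(x, y)`. -/
def formComp (φ : OpenPartialHomeomorph M (Coord n))
    (b : (p : M) → TangentSpace (𝓡 n) p →ₗ[ℝ] ℝ) (i : Fin n) : Coord n → Coord n → ℝ :=
  fun x _ => localExpr φ (formFun b) x (EuclideanSpace.single i 1)

/-- The β-conformal change `L̄ = e^σ L + β`. -/
def betaConformal (σ : M → ℝ) (b : (p : M) → TangentSpace (𝓡 n) p →ₗ[ℝ] ℝ)
    (L : TangentBundle (𝓡 n) M → ℝ) : TangentBundle (𝓡 n) M → ℝ :=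
  fun v => Real.exp (σ v.1) * L v + formFun b v

/-- `bᵢ` is parallel for the Cartan connection of `(M, L)`: `b_{i|j} = 0` at every point of the
slit tangent bundle, in all coordinates. -/
def IsCartanParallel [IsManifold (𝓡 n) ∞ M] (L : TangentBundle (𝓡 n) M → ℝ)
    (b : (p : M) → TangentSpace (𝓡 n) p →ₗ[ℝ] ℝ) : Prop :=
  ∀ φ ∈ IsManifold.maximalAtlas (𝓡 n) ∞ M, ∀ x ∈ φ.target, ∀ y : Coord n, y ≠ 0 →
    ∀ i j, hCovDeriv (localExpr φ L) (formComp φ b) i j x y = 0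

/-- The components, in a chart, of the difference tensor `Dⁱⱼₖ = Γ̄ⁱⱼₖ - Γⁱⱼₖ` of the Cartan
connections of `L` and `L'`. -/
def differenceTensor (φ : OpenPartialHomeomorph M (Coord n)) (L L' : TangentBundle (𝓡 n) M → ℝ)
    (i j k : Fin n) : Coord n → Coord n → ℝ :=
  fun x y => cartanConn (localExpr φ L') i j k x y - cartanConn (localExpr φ L) i j k x y

/-- The difference tensor vanishes identically (on the slit tangent bundle). -/
def DifferenceVanishes [IsManifold (𝓡 n) ∞ M] (L L' : TangentBundle (𝓡 n) M → ℝ) : Prop :=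
  ∀ φ ∈ IsManifold.maximalAtlas (𝓡 n) ∞ M, ∀ x ∈ φ.target, ∀ y : Coord n, y ≠ 0 →
    ∀ i j k, differenceTensor φ L L' i j k x y = 0

/-- `σ` is homothetic: `σᵢ = ∂σ/∂xⁱ` vanishes everywhere, in all coordinates. -/
def IsHomothetic [IsManifold (𝓡 n) ∞ M] (σ : M → ℝ) : Prop :=
  ∀ φ ∈ IsManifold.maximalAtlas (𝓡 n) ∞ M, ∀ x ∈ φ.target, ∀ i : Fin n,
    fderiv ℝ (fun x' => σ (φ.symm x')) x (EuclideanSpace.single i 1) = 0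

end Finsler

end

noncomputable section

namespace Finsler

variable {n : ℕ}

/-! ### Calculus on the slit domain -/

/-! Everything is checked in a chart. Write `lᵢ = ∂̇ᵢL`, `l̄ᵢ = ∂̇ᵢL̄`. For the Cartan connection
`gᵢⱼ` is horizontally parallel and `δₖyⁱ = -Nⁱₖ = -Γⁱⱼₖyʲ`, so `δₖL = 0` (`hDeriv_self`) and
`l_{i|k} = 0` (`hCovDeriv_dy`).

Hence `δₖL̄ = e^σ σₖ L + b_{i|k}yⁱ` (`hDeriv_eq`). If `D = 0`, contracting with `y` gives `N̄ = N`,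
so `δ̄ = δ` and `δₖL̄ = 0`; if also `b` is parallel, only `e^σ σₖ L = 0` remains, and `σₖ = 0`.

Let now `σₖ = 0`. Since `l̄ᵢ = e^σ lᵢ + bᵢ`, the derivative of `l̄ᵢ` for the connection of `L` is
`b_{i|k}` (`hCovDeriv_dy_eq`). When `D = 0` it is also the derivative for the connection of `L̄`,
hence zero. Conversely, if `b` is parallel, every ingredient of `L ḡᵢⱼ = L l̄ᵢl̄ⱼ + e^σ L̄ (gᵢⱼ -
lᵢlⱼ)` is parallel for `Γ`, hence so is `ḡ` (`hDeriv_fund_eq`). As `Γ` is symmetric and `N = Γy`,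
the uniqueness theorem `cartanConn_eq_of_compatible` forces `Γ̄ = Γ`. -/

/-- `f (x, y)` is smooth for `x ∈ U` and `y ≠ 0`. -/
def SlitSmooth (U : Set (Coord n)) (f : Coord n → Coord n → ℝ) : Prop :=
  ContDiffOn ℝ ∞ (fun p : Coord n × Coord n => f p.1 p.2) (U ×ˢ {0}ᶜ)

theorem isOpen_slit {U : Set (Coord n)} (hU : IsOpen U) :
    IsOpen (U ×ˢ ({0}ᶜ : Set (Coord n))) :=
  hU.prod isOpen_compl_singleton

theorem SlitSmooth.contDiffAt {U : Set (Coord n)} (hU : IsOpen U) {f : Coord n → Coord n → ℝ}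
    (hf : SlitSmooth U f) {x y : Coord n} (hx : x ∈ U) (hy : y ≠ 0) :
    ContDiffAt ℝ ∞ (fun p : Coord n × Coord n => f p.1 p.2) (x, y) :=
  ContDiffOn.contDiffAt hf ((isOpen_slit hU).mem_nhds ⟨hx, hy⟩)

theorem SlitSmooth.differentiableAt {U : Set (Coord n)} (hU : IsOpen U)
    {f : Coord n → Coord n → ℝ} (hf : SlitSmooth U f) {x y : Coord n} (hx : x ∈ U) (hy : y ≠ 0) :
    DifferentiableAt ℝ (fun p : Coord n × Coord n => f p.1 p.2) (x, y) :=
  (hf.contDiffAt hU hx hy).differentiableAt (by simp)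

theorem dx_eq_fderiv {f : Coord n → Coord n → ℝ} {x y : Coord n} (i : Fin n)
    (hf : DifferentiableAt ℝ (fun p : Coord n × Coord n => f p.1 p.2) (x, y)) :
    dx i f x y = fderiv ℝ (fun p : Coord n × Coord n => f p.1 p.2) (x, y)
      (EuclideanSpace.single i 1, 0) := by
  have h := HasFDerivAt.comp x (f := fun x' : Coord n => (x', y)) hf.hasFDerivAt
    (hasFDerivAt_prodMk_left x y)
  have h2 : HasFDerivAt (fun x' => f x' y) _ x := h
  simp [dx, h2.fderiv]

theorem dy_eq_fderiv {f : Coord n → Coord n → ℝ} {x y : Coord n} (i : Fin n)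
    (hf : DifferentiableAt ℝ (fun p : Coord n × Coord n => f p.1 p.2) (x, y)) :
    dy i f x y = fderiv ℝ (fun p : Coord n × Coord n => f p.1 p.2) (x, y)
      (0, EuclideanSpace.single i 1) := by
  have h := HasFDerivAt.comp y (f := fun y' : Coord n => (x, y')) hf.hasFDerivAt
    (hasFDerivAt_prodMk_right x y)
  have h2 : HasFDerivAt (fun y' => f x y') _ y := h
  simp [dy, h2.fderiv]

/-- At a fixed point `δₖ` is differentiation along one tangent vector of the `(x, y)`-space, so it
inherits all derivation rules from `fderiv`. -/
theorem hDeriv_eq_fderiv (F : Coord n → Coord n → ℝ) {f : Coord n → Coord n → ℝ} {x y : Coord n}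
    (k : Fin n) (hf : DifferentiableAt ℝ (fun p : Coord n × Coord n => f p.1 p.2) (x, y)) :
    hDeriv F k f x y = fderiv ℝ (fun p : Coord n × Coord n => f p.1 p.2) (x, y)
      ((EuclideanSpace.single k 1, 0) -
        ∑ r, nonlinearConn F r k x y • (0, EuclideanSpace.single r 1)) := by
  simp only [hDeriv, dx_eq_fderiv k hf, dy_eq_fderiv _ hf, map_sub, map_sum, map_smul, smul_eq_mul]

theorem SlitSmooth.fderiv_apply {U : Set (Coord n)} (hU : IsOpen U) {f : Coord n → Coord n → ℝ}
    (hf : SlitSmooth U f) (v : Coord n × Coord n) :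
    SlitSmooth U fun x y => fderiv ℝ (fun p : Coord n × Coord n => f p.1 p.2) (x, y) v :=
  (ContDiffOn.fderiv_of_isOpen hf (isOpen_slit hU) (m := ∞) (by simp)).clm_apply contDiffOn_const

theorem SlitSmooth.congr {U : Set (Coord n)} {f g : Coord n → Coord n → ℝ} (hf : SlitSmooth U f)
    (h : ∀ x ∈ U, ∀ y, y ≠ 0 → g x y = f x y) : SlitSmooth U g :=
  ContDiffOn.congr hf fun p hp => h p.1 hp.1 p.2 hp.2

theorem SlitSmooth.dy {U : Set (Coord n)} (hU : IsOpen U) {f : Coord n → Coord n → ℝ}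
    (hf : SlitSmooth U f) (i : Fin n) : SlitSmooth U (dy i f) :=
  (hf.fderiv_apply hU _).congr fun _ hx _ hy => dy_eq_fderiv i (hf.differentiableAt hU hx hy)

theorem SlitSmooth.mul {U : Set (Coord n)} {f g : Coord n → Coord n → ℝ} (hf : SlitSmooth U f)
    (hg : SlitSmooth U g) : SlitSmooth U fun x y => f x y * g x y :=
  ContDiffOn.mul hf hg

theorem SlitSmooth.add {U : Set (Coord n)} {f g : Coord n → Coord n → ℝ} (hf : SlitSmooth U f)
    (hg : SlitSmooth U g) : SlitSmooth U fun x y => f x y + g x y :=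
  ContDiffOn.add hf hg

theorem SlitSmooth.sub {U : Set (Coord n)} {f g : Coord n → Coord n → ℝ} (hf : SlitSmooth U f)
    (hg : SlitSmooth U g) : SlitSmooth U fun x y => f x y - g x y :=
  ContDiffOn.sub hf hg

theorem SlitSmooth.sum {ι : Type*} {s : Finset ι} {U : Set (Coord n)}
    {f : ι → Coord n → Coord n → ℝ} (hf : ∀ i, SlitSmooth U (f i)) :
    SlitSmooth U fun x y => ∑ i ∈ s, f i x y :=
  ContDiffOn.sum fun i _ => hf i

theorem slitSmooth_coord (U : Set (Coord n)) (i : Fin n) : SlitSmooth U fun _ y => y i := by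
  unfold SlitSmooth
  fun_prop

theorem slitSmooth_const (U : Set (Coord n)) (c : ℝ) : SlitSmooth U fun _ _ => c :=
  contDiffOn_const

theorem SlitSmooth.energy {U : Set (Coord n)} {F : Coord n → Coord n → ℝ} (hF : SlitSmooth U F) :
    SlitSmooth U (energy F) :=
  (ContDiffOn.pow hF 2).div_const 2

theorem SlitSmooth.fund {U : Set (Coord n)} (hU : IsOpen U) {F : Coord n → Coord n → ℝ}
    (hF : SlitSmooth U F) (i j : Fin n) : SlitSmooth U (fund F i j) :=
  (hF.energy.dy hU j).dy hU i

/-! ### Locality, derivation rules and symmetry of second derivatives. -/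

section Rules

variable {U : Set (Coord n)} (hU : IsOpen U) {f g : Coord n → Coord n → ℝ} {x y : Coord n}
  (hx : x ∈ U) (hy : y ≠ 0)

include hU hx hy

theorem eventuallyEq_of_slit (h : ∀ x ∈ U, ∀ y, y ≠ 0 → f x y = g x y) :
    (fun p : Coord n × Coord n => f p.1 p.2) =ᶠ[nhds (x, y)] fun p => g p.1 p.2 := by
  filter_upwards [(isOpen_slit hU).mem_nhds (⟨hx, hy⟩ : (x, y) ∈ U ×ˢ ({0}ᶜ : Set (Coord n)))]
    with p hp using h p.1 hp.1 p.2 hp.2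

theorem dy_congr (i : Fin n) (hg : SlitSmooth U g)
    (h : ∀ x ∈ U, ∀ y, y ≠ 0 → f x y = g x y) : dy i f x y = dy i g x y := by
  rw [dy_eq_fderiv i (hg.differentiableAt hU hx hy),
    dy_eq_fderiv i ((hg.congr h).differentiableAt hU hx hy),
    (eventuallyEq_of_slit hU hx hy h).fderiv_eq]

theorem hDeriv_congr (F : Coord n → Coord n → ℝ) (k : Fin n) (hg : SlitSmooth U g)
    (h : ∀ x ∈ U, ∀ y, y ≠ 0 → f x y = g x y) : hDeriv F k f x y = hDeriv F k g x y := by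
  rw [hDeriv_eq_fderiv F k (hg.differentiableAt hU hx hy),
    hDeriv_eq_fderiv F k ((hg.congr h).differentiableAt hU hx hy),
    (eventuallyEq_of_slit hU hx hy h).fderiv_eq]

theorem dy_mul (i : Fin n) (hf : SlitSmooth U f) (hg : SlitSmooth U g) :
    dy i (fun x y => f x y * g x y) x y = dy i f x y * g x y + f x y * dy i g x y := by
  rw [dy_eq_fderiv i (hf.differentiableAt hU hx hy), dy_eq_fderiv i (hg.differentiableAt hU hx hy),
    dy_eq_fderiv i ((hf.mul hg).differentiableAt hU hx hy),
    fderiv_fun_mul (hf.differentiableAt hU hx hy) (hg.differentiableAt hU hx hy)]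
  simp
  ring

theorem dy_add (i : Fin n) (hf : SlitSmooth U f) (hg : SlitSmooth U g) :
    dy i (fun x y => f x y + g x y) x y = dy i f x y + dy i g x y := by
  rw [dy_eq_fderiv i (hf.differentiableAt hU hx hy), dy_eq_fderiv i (hg.differentiableAt hU hx hy),
    dy_eq_fderiv i ((hf.add hg).differentiableAt hU hx hy),
    fderiv_fun_add (hf.differentiableAt hU hx hy) (hg.differentiableAt hU hx hy)]
  simp

theorem dy_sum {ι : Type*} (s : Finset ι) {f : ι → Coord n → Coord n → ℝ} (i : Fin n)
    (hf : ∀ j, SlitSmooth U (f j)) :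
    dy i (fun x y => ∑ j ∈ s, f j x y) x y = ∑ j ∈ s, dy i (f j) x y := by
  rw [dy_eq_fderiv i ((SlitSmooth.sum hf).differentiableAt hU hx hy),
    fderiv_fun_sum fun j _ => (hf j).differentiableAt hU hx hy]
  simp [dy_eq_fderiv i ((hf _).differentiableAt hU hx hy)]

theorem hDeriv_mul (F : Coord n → Coord n → ℝ) (k : Fin n) (hf : SlitSmooth U f)
    (hg : SlitSmooth U g) : hDeriv F k (fun x y => f x y * g x y) x y =
      hDeriv F k f x y * g x y + f x y * hDeriv F k g x y := by
  rw [hDeriv_eq_fderiv F k (hf.differentiableAt hU hx hy),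
    hDeriv_eq_fderiv F k (hg.differentiableAt hU hx hy),
    hDeriv_eq_fderiv F k ((hf.mul hg).differentiableAt hU hx hy),
    fderiv_fun_mul (hf.differentiableAt hU hx hy) (hg.differentiableAt hU hx hy)]
  simp only [add_apply, smul_apply, smul_eq_mul]
  ring

theorem hDeriv_add (F : Coord n → Coord n → ℝ) (k : Fin n) (hf : SlitSmooth U f)
    (hg : SlitSmooth U g) : hDeriv F k (fun x y => f x y + g x y) x y =
      hDeriv F k f x y + hDeriv F k g x y := by
  rw [hDeriv_eq_fderiv F k (hf.differentiableAt hU hx hy),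
    hDeriv_eq_fderiv F k (hg.differentiableAt hU hx hy),
    hDeriv_eq_fderiv F k ((hf.add hg).differentiableAt hU hx hy),
    fderiv_fun_add (hf.differentiableAt hU hx hy) (hg.differentiableAt hU hx hy)]
  rfl

theorem hDeriv_sub (F : Coord n → Coord n → ℝ) (k : Fin n) (hf : SlitSmooth U f)
    (hg : SlitSmooth U g) : hDeriv F k (fun x y => f x y - g x y) x y =
      hDeriv F k f x y - hDeriv F k g x y := by
  rw [hDeriv_eq_fderiv F k (hf.differentiableAt hU hx hy),
    hDeriv_eq_fderiv F k (hg.differentiableAt hU hx hy),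
    hDeriv_eq_fderiv F k ((hf.sub hg).differentiableAt hU hx hy),
    fderiv_fun_sub (hf.differentiableAt hU hx hy) (hg.differentiableAt hU hx hy)]
  rfl

theorem hDeriv_sum {ι : Type*} (s : Finset ι) {f : ι → Coord n → Coord n → ℝ}
    (F : Coord n → Coord n → ℝ) (k : Fin n) (hf : ∀ j, SlitSmooth U (f j)) :
    hDeriv F k (fun x y => ∑ j ∈ s, f j x y) x y = ∑ j ∈ s, hDeriv F k (f j) x y := by
  rw [hDeriv_eq_fderiv F k ((SlitSmooth.sum hf).differentiableAt hU hx hy),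
    fderiv_fun_sum fun j _ => (hf j).differentiableAt hU hx hy, sum_apply]
  exact Finset.sum_congr rfl fun j _ =>
    (hDeriv_eq_fderiv F k ((hf j).differentiableAt hU hx hy)).symm

theorem dy_comm (hf : SlitSmooth U f) (i j : Fin n) :
    dy i (dy j f) x y = dy j (dy i f) x y := by
  have hs : ContDiffAt ℝ ∞ (f x) y :=
    (hf.contDiffAt hU hx hy).comp y (f := fun y' => (x, y')) (by fun_prop)
  have hd : DifferentiableAt ℝ (fderiv ℝ (f x)) y :=
    (hs.fderiv_right (m := 1) (by norm_cast)).differentiableAt (by simp)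
  have key : ∀ k l : Fin n, dy k (dy l f) x y =
      fderiv ℝ (fderiv ℝ (f x)) y (EuclideanSpace.single k 1) (EuclideanSpace.single l 1) := by
    intro k l
    change fderiv ℝ (fun y' => fderiv ℝ (f x) y' (EuclideanSpace.single l 1)) y _ = _
    rw [fderiv_clm_apply hd (by fun_prop)]
    simp
  rw [key, key]
  have h2 : ContDiffAt ℝ 2 (f x) y := hs.of_le (by norm_cast)
  exact (h2.isSymmSndFDerivAt (by simp)).eq _ _

end Rules

theorem dy_coord (i j : Fin n) (x y : Coord n) :
    dy i (fun _ y => y j) x y = if i = j then 1 else 0 := by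
  have h : (fun y : Coord n => y j) = EuclideanSpace.proj (𝕜 := ℝ) j := rfl
  simp only [dy, h, ContinuousLinearMap.fderiv]
  simp [eq_comm]

theorem hDeriv_coord (F : Coord n → Coord n → ℝ) (k j : Fin n) (x y : Coord n) :
    hDeriv F k (fun _ y => y j) x y = -nonlinearConn F j k x y := by
  simp [hDeriv, dy_coord, dx]

/-- Expand `y` in the standard basis; this links Euler's relation to the derivative along the ray
through `y`. -/
theorem sum_dy_mul_coord {f : Coord n → Coord n → ℝ} {x y : Coord n} :
    ∑ j, dy j f x y * y j = fderiv ℝ (f x) y y := by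
  conv_rhs => enter [2]; rw [← (EuclideanSpace.basisFun (Fin n) ℝ).sum_repr y]
  simp [dy, mul_comm]

/-! ### Finsler functions in coordinates -/

/-- `F (x, y)` is a Finsler function over the coordinate domain `U`; the homogeneity is given
by Euler's relation. -/
structure IsLocalMetric (U : Set (Coord n)) (F : Coord n → Coord n → ℝ) : Prop where
  isOpen : IsOpen U
  smooth : SlitSmooth U F
  euler : ∀ x ∈ U, ∀ y, y ≠ 0 → ∑ j, dy j F x y * y j = F x y
  pos : ∀ x ∈ U, ∀ y, y ≠ 0 → 0 < F x y
  posDef : ∀ x ∈ U, ∀ y, y ≠ 0 → (fundMatrix F x y).PosDef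

namespace IsLocalMetric

variable {U : Set (Coord n)} {F : Coord n → Coord n → ℝ} (hF : IsLocalMetric U F)
  {x y : Coord n} (hx : x ∈ U) (hy : y ≠ 0)

include hF hx hy

theorem dy_energy (i : Fin n) : dy i (energy F) x y = F x y * dy i F x y := by
  rw [dy_congr hF.isOpen hx hy i (g := fun x y => F x y * (F x y * (1 / 2)))
      (hF.smooth.mul (hF.smooth.mul (slitSmooth_const U _)))
      (fun x _ y _ => by simp only [energy]; ring),
    dy_mul hF.isOpen hx hy i hF.smooth (hF.smooth.mul (slitSmooth_const U _)),
    dy_mul hF.isOpen hx hy i hF.smooth (slitSmooth_const U _)]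
  have : dy i (fun _ _ => (1 / 2 : ℝ)) x y = 0 := by simp [dy]
  rw [this]
  ring

theorem fund_eq (i j : Fin n) :
    fund F i j x y = dy i F x y * dy j F x y + F x y * dy i (dy j F) x y := by
  have h := hF.smooth.dy hF.isOpen j
  rw [fund, dy_congr hF.isOpen hx hy i (hF.smooth.mul h)
    (fun x hx y hy => hF.dy_energy hx hy j), dy_mul hF.isOpen hx hy i hF.smooth h]

theorem fund_symm (i j : Fin n) : fund F i j x y = fund F j i x y :=
  dy_comm hF.isOpen hx hy hF.smooth.energy i j

theorem dy_fund_symm (i j k : Fin n) : dy k (fund F i j) x y = dy k (fund F j i) x y :=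
  dy_congr hF.isOpen hx hy k (hF.smooth.fund hF.isOpen j i) fun _ hx _ hy => hF.fund_symm hx hy i j

theorem hDeriv_fund_symm (H : Coord n → Coord n → ℝ) (i j k : Fin n) :
    hDeriv H k (fund F i j) x y = hDeriv H k (fund F j i) x y :=
  hDeriv_congr hF.isOpen hx hy H k (hF.smooth.fund hF.isOpen j i)
    fun _ hx _ hy => hF.fund_symm hx hy i j

/-- Differentiate Euler's relation: the term in which `∂̇ᵢ` hits `yʲ` cancels the right-hand side.
-/
theorem sum_dy_dy_mul_coord (i : Fin n) : ∑ j, dy i (dy j F) x y * y j = 0 := by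
  have hs := fun j => hF.smooth.dy hF.isOpen j
  have h := dy_congr hF.isOpen hx hy i hF.smooth hF.euler
  rw [dy_sum hF.isOpen hx hy _ i (fun j => (hs j).mul (slitSmooth_coord U j))] at h
  simp only [fun j => dy_mul hF.isOpen hx hy i (hs j) (slitSmooth_coord U j), dy_coord,
    Finset.sum_add_distrib] at h
  simpa using h

theorem sum_fund_mul_coord (i : Fin n) :
    ∑ j, fund F i j x y * y j = dy i (energy F) x y := by
  have h1 := hF.sum_dy_dy_mul_coord hx hy i
  have h2 := hF.euler x hx y hy
  calc ∑ j, fund F i j x y * y j = dy i F x y * ∑ j, dy j F x y * y j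
        + F x y * ∑ j, dy i (dy j F) x y * y j := by
        simp only [Finset.mul_sum, ← Finset.sum_add_distrib]
        exact Finset.sum_congr rfl fun j _ => by rw [hF.fund_eq hx hy]; ring
    _ = _ := by rw [h1, h2, hF.dy_energy hx hy]; ring

/-- Differentiating `gᵢⱼyʲ = ∂̇ᵢE` gives `gᵢₖ` on both sides. This is `Cᵢⱼₖyʲ = 0`, the reason
Cartan-tensor terms disappear under contraction with `y`. -/
theorem sum_dy_fund_mul_coord (i k : Fin n) : ∑ j, dy k (fund F i j) x y * y j = 0 := by
  have hs := fun j => hF.smooth.fund hF.isOpen i j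
  have h := dy_congr hF.isOpen hx hy k (hF.smooth.energy.dy hF.isOpen i)
    fun x hx y hy => hF.sum_fund_mul_coord hx hy i
  rw [dy_sum hF.isOpen hx hy _ k (fun j => (hs j).mul (slitSmooth_coord U j))] at h
  simp only [fun j => dy_mul hF.isOpen hx hy k (hs j) (slitSmooth_coord U j), dy_coord,
    Finset.sum_add_distrib] at h
  have h3 := hF.fund_symm hx hy i k
  simp only [mul_ite, mul_one, mul_zero, Finset.sum_ite_eq, Finset.mem_univ, if_true] at h
  rw [h3] at h
  exact left_eq_add.1 (h.trans rfl |>.symm.trans (add_comm _ _))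

theorem sum_fund_mul_sum_fundInv (m : Fin n) (S : Fin n → ℝ) :
    ∑ i, fund F m i x y * ∑ l, fundInv F i l x y * S l = S m := by
  have h : fundMatrix F x y * (fundMatrix F x y)⁻¹ = 1 :=
    Matrix.mul_nonsing_inv _ ((Matrix.isUnit_iff_isUnit_det _).1 (hF.posDef x hx y hy).isUnit)
  have h2 : (fundMatrix F x y).mulVec ((fundMatrix F x y)⁻¹.mulVec S) = S := by
    rw [Matrix.mulVec_mulVec, h, Matrix.one_mulVec]
  exact congrFun h2 m

/-- Positive definiteness makes lowering an index injective, so identities for connection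
coefficients can be proved without the inverse metric. -/
theorem eq_of_sum_fund_mul_eq {u v : Fin n → ℝ}
    (h : ∀ m, ∑ i, fund F m i x y * u i = ∑ i, fund F m i x y * v i) (i : Fin n) : u i = v i :=
  congrFun (Matrix.mulVec_injective_of_isUnit (hF.posDef x hx y hy).isUnit
    (funext h : (fundMatrix F x y).mulVec u = (fundMatrix F x y).mulVec v)) i

theorem sum_fund_mul_cartanConn (m j k : Fin n) :
    ∑ i, fund F m i x y * cartanConn F i j k x y = (1 / 2) * (hDeriv F j (fund F m k) x y
      + hDeriv F k (fund F j m) x y - hDeriv F m (fund F j k) x y) := by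
  simp only [cartanConn, mul_left_comm _ (1 / 2 : ℝ)]
  rw [← Finset.mul_sum, hF.sum_fund_mul_sum_fundInv hx hy m fun l => hDeriv F j (fund F l k) x y
      + hDeriv F k (fund F j l) x y - hDeriv F l (fund F j k) x y]

theorem sum_fund_mul_christoffel (m j k : Fin n) :
    ∑ i, fund F m i x y * christoffel F i j k x y = (1 / 2) * (dx j (fund F m k) x y
      + dx k (fund F j m) x y - dx m (fund F j k) x y) := by
  simp only [christoffel, mul_left_comm _ (1 / 2 : ℝ)]
  rw [← Finset.mul_sum, hF.sum_fund_mul_sum_fundInv hx hy m fun l => dx j (fund F l k) x y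
      + dx k (fund F j l) x y - dx l (fund F j k) x y]

theorem sum_fund_mul_cartanTorsion (m j k : Fin n) :
    ∑ i, fund F m i x y * cartanTorsion F i j k x y = cartanTensor F m j k x y :=
  hF.sum_fund_mul_sum_fundInv hx hy m fun l => cartanTensor F l j k x y

theorem sum_cartanTensor_mul_coord (i k : Fin n) :
    ∑ j, cartanTensor F i j k x y * y j = 0 := by
  simp only [cartanTensor, mul_assoc, ← Finset.mul_sum, hF.sum_dy_fund_mul_coord hx hy, mul_zero]

theorem sum_cartanTorsion_mul_coord (i k : Fin n) :
    ∑ j, cartanTorsion F i j k x y * y j = 0 := by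
  simp only [cartanTorsion, Finset.sum_mul]
  rw [Finset.sum_comm]
  simp only [mul_assoc, ← Finset.mul_sum, hF.sum_cartanTensor_mul_coord hx hy, mul_zero,
    Finset.sum_const_zero]

/-- `γᵢⱼₖ yᵏ = gᵢᵣ Nʳⱼ + Cᵢⱼₖ γᵏᵣₛ yʳ yˢ`. -/
theorem sum_fund_mul_nonlinearConn (m j : Fin n) :
    ∑ i, fund F m i x y * nonlinearConn F i j x y =
      ∑ k, (1 / 2) * (dx j (fund F m k) x y + dx k (fund F j m) x y - dx m (fund F j k) x y) * y k
      - ∑ k, cartanTensor F m j k x y * ∑ r, ∑ s, christoffel F k r s x y * y r * y s := by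
  simp only [nonlinearConn, mul_sub, Finset.sum_sub_distrib, Finset.mul_sum (Finset.univ)
    (fun k => christoffel F _ j k x y * y k), Finset.mul_sum (Finset.univ)
    (fun k => cartanTorsion F _ j k x y * _), ← mul_assoc]
  rw [Finset.sum_comm, Finset.sum_comm (f := fun i k => fund F m i x y *
    cartanTorsion F i j k x y * _)]
  simp only [← Finset.sum_mul, hF.sum_fund_mul_christoffel hx hy,
    hF.sum_fund_mul_cartanTorsion hx hy, mul_sub]

theorem sum_nonlinearConn_mul_coord (i : Fin n) :
    ∑ j, nonlinearConn F i j x y * y j = ∑ r, ∑ s, christoffel F i r s x y * y r * y s := by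
  have h : ∑ j, (∑ k, cartanTorsion F i j k x y * ∑ r, ∑ s, christoffel F k r s x y * y r * y s)
      * y j = 0 := by
    simp only [Finset.sum_mul _ _ (y _)]
    rw [Finset.sum_comm]
    refine Finset.sum_eq_zero fun k _ => ?_
    simp only [mul_right_comm _ (∑ r, _)]
    rw [← Finset.sum_mul, hF.sum_cartanTorsion_mul_coord hx hy, zero_mul]
  simp only [nonlinearConn, sub_mul, Finset.sum_sub_distrib]
  rw [h, sub_zero]
  simp only [Finset.sum_mul]
  exact Finset.sum_congr rfl fun j _ => Finset.sum_congr rfl fun k _ => mul_right_comm _ _ _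

theorem cartanConn_symm (i j k : Fin n) :
    cartanConn F i j k x y = cartanConn F i k j x y := by
  simp only [cartanConn]
  congr 1
  refine Finset.sum_congr rfl fun l _ => ?_
  rw [hF.hDeriv_fund_symm hx hy F l k, hF.hDeriv_fund_symm hx hy F j l,
    hF.hDeriv_fund_symm hx hy F j k]
  ring

/-- The horizontal covariant derivative of `gᵢⱼ` vanishes. -/
theorem hDeriv_fund (i j k : Fin n) :
    hDeriv F k (fund F i j) x y = ∑ r, fund F r j x y * cartanConn F r i k x y
      + ∑ r, fund F i r x y * cartanConn F r j k x y := by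
  simp only [hF.fund_symm hx hy _ j]
  rw [hF.sum_fund_mul_cartanConn hx hy, hF.sum_fund_mul_cartanConn hx hy,
    hF.hDeriv_fund_symm hx hy F j k, hF.hDeriv_fund_symm hx hy F j i,
    hF.hDeriv_fund_symm hx hy F i k]
  ring

/-- Lowered form of `∂ⱼ = δⱼ + Nʳⱼ ∂̇ᵣ` in the Christoffel symbols, contracted with `y`. -/
theorem sum_christoffel_mul_coord (N : Fin n → Fin n → ℝ) (δ : Fin n → Fin n → Fin n → ℝ)
    (hδ : ∀ i j k, dx k (fund F i j) x y = δ k i j + ∑ r, N r k * dy r (fund F i j) x y)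
    (m j : Fin n) :
    ∑ k, (1 / 2) * (dx j (fund F m k) x y + dx k (fund F j m) x y - dx m (fund F j k) x y) * y k
      = ∑ k, (1 / 2) * (δ j m k + δ k j m - δ m j k) * y k
        + ∑ r, cartanTensor F m j r x y * ∑ k, N r k * y k := by
  -- When `y` is contracted into an index of `g`, the vertical term vanishes by homogeneity; only
  -- the one with `y` on the index of `N` survives.
  have h0 : ∀ i l, ∑ k, (∑ r, N r l * dy r (fund F i k) x y) * y k = 0 := by
    intro i l
    simp only [Finset.sum_mul]
    rw [Finset.sum_comm]
    simp only [mul_assoc, ← Finset.mul_sum, hF.sum_dy_fund_mul_coord hx hy, mul_zero,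
      Finset.sum_const_zero]
  have h1 : ∑ r, cartanTensor F m j r x y * ∑ k, N r k * y k =
      (1 / 2) * ∑ k, (∑ r, N r k * dy r (fund F j m) x y) * y k := by
    simp only [cartanTensor, Finset.mul_sum, Finset.sum_mul]
    rw [Finset.sum_comm]
    refine Finset.sum_congr rfl fun k _ => Finset.sum_congr rfl fun r _ => ?_
    rw [hF.dy_fund_symm hx hy m j]
    ring
  have h2 := h0 m j
  have h3 := h0 j m
  calc _ = ∑ k, (1 / 2) * (δ j m k + δ k j m - δ m j k) * y k
        + ((1 / 2) * ∑ k, (∑ r, N r k * dy r (fund F j m) x y) * y k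
          + (1 / 2) * ∑ k, (∑ r, N r j * dy r (fund F m k) x y) * y k
          - (1 / 2) * ∑ k, (∑ r, N r m * dy r (fund F j k) x y) * y k) := by
        simp only [hδ, Finset.mul_sum (Finset.univ) (fun k => (∑ r, _) * y k),
          ← Finset.sum_add_distrib, ← Finset.sum_sub_distrib]
        exact Finset.sum_congr rfl fun k _ => by ring
    _ = _ := by rw [h1, h2, h3]; ring

/-- `Γⁱⱼₖ yᵏ = Nⁱⱼ`. -/
theorem sum_cartanConn_mul_coord (i j : Fin n) :
    ∑ k, cartanConn F i j k x y * y k = nonlinearConn F i j x y := by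
  refine hF.eq_of_sum_fund_mul_eq hx hy (u := fun i => ∑ k, cartanConn F i j k x y * y k)
    (v := fun i => nonlinearConn F i j x y) (fun m => ?_) i
  rw [hF.sum_fund_mul_nonlinearConn hx hy,
    hF.sum_christoffel_mul_coord hx hy (fun r k => nonlinearConn F r k x y)
      (fun k i j => hDeriv F k (fund F i j) x y) (fun i j k => by simp only [hDeriv]; ring)]
  -- Since `Nʳₖyᵏ = γʳₖₛyᵏyˢ`, the two Cartan-tensor corrections are equal and cancel.
  simp only [hF.sum_nonlinearConn_mul_coord hx hy, add_sub_cancel_right, Finset.mul_sum,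
    ← mul_assoc]
  rw [Finset.sum_comm]
  simp only [← Finset.sum_mul, hF.sum_fund_mul_cartanConn hx hy]

theorem sum_cartanConn_mul_coord' (i k : Fin n) :
    ∑ j, cartanConn F i j k x y * y j = nonlinearConn F i k x y := by
  rw [← hF.sum_cartanConn_mul_coord hx hy]
  exact Finset.sum_congr rfl fun j _ => by rw [hF.cartanConn_symm hx hy]

/-! ### Uniqueness: `hcompat` takes its nonlinear connection from `A` itself. -/

section Uniqueness

variable {A : Fin n → Fin n → Fin n → ℝ} (hA : ∀ i j k, A i j k = A i k j)
  (hcompat : ∀ i j k, dx k (fund F i j) x y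
    - ∑ r, (∑ s, A r k s * y s) * dy r (fund F i j) x y =
      ∑ r, fund F r j x y * A r i k + ∑ r, fund F i r x y * A r j k)

include hA hcompat

/-- A symmetric metrical connection whose deflection vanishes induces the Cartan nonlinear
connection. -/
theorem nonlinearConn_eq_of_compatible (i j : Fin n) :
    nonlinearConn F i j x y = ∑ k, A i j k * y k := by
  set N : Fin n → Fin n → ℝ := fun r k => ∑ s, A r k s * y s with hN
  have key : ∀ m j, ∑ k, (1 / 2) * (dx j (fund F m k) x y + dx k (fund F j m) x y
      - dx m (fund F j k) x y) * y k = ∑ r, fund F m r x y * N r j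
        + ∑ r, cartanTensor F m j r x y * ∑ k, N r k * y k := by
    intro m j
    rw [hF.sum_christoffel_mul_coord hx hy N (fun k i j => ∑ r, fund F r j x y * A r i k
      + ∑ r, fund F i r x y * A r j k) (fun i j k => by rw [← hcompat]; ring)]
    congr 1
    simp only [hN, Finset.mul_sum, ← mul_assoc]
    rw [Finset.sum_comm]
    simp only [← Finset.sum_mul]
    refine Finset.sum_congr rfl fun k _ => ?_
    congr 1
    simp only [hF.fund_symm hx hy _ m, hF.fund_symm hx hy _ k,
      hA _ m, hA _ j k]
    ring
  -- A second contraction with `y` kills the Cartan-tensor term of `key`. So `Nʲₖyᵏ` is the spray of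
  -- `F`, and the correction left in `key` is the one defining `nonlinearConn`.
  have spray : ∀ i, ∑ r, ∑ s, christoffel F i r s x y * y r * y s = ∑ j, N i j * y j := by
    refine hF.eq_of_sum_fund_mul_eq hx hy fun m => ?_
    have h1 : ∑ i, fund F m i x y * ∑ r, ∑ s, christoffel F i r s x y * y r * y s =
        ∑ j, (∑ k, (1 / 2) * (dx j (fund F m k) x y + dx k (fund F j m) x y
          - dx m (fund F j k) x y) * y k) * y j := by
      simp only [Finset.mul_sum, Finset.sum_mul]
      rw [Finset.sum_comm]
      refine Finset.sum_congr rfl fun j _ => ?_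
      rw [Finset.sum_comm]
      refine Finset.sum_congr rfl fun k _ => ?_
      rw [← hF.sum_fund_mul_christoffel hx hy, Finset.sum_mul, Finset.sum_mul]
      exact Finset.sum_congr rfl fun i _ => by ring
    rw [h1]
    simp only [key, add_mul, Finset.sum_add_distrib]
    have h2 : ∑ j, (∑ r, cartanTensor F m j r x y * ∑ k, N r k * y k) * y j = 0 := by
      simp only [Finset.sum_mul]
      rw [Finset.sum_comm]
      simp only [mul_right_comm _ _ (y _)]
      simp only [← Finset.sum_mul, hF.sum_cartanTensor_mul_coord hx hy, zero_mul,
        Finset.sum_const_zero]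
    rw [h2, add_zero]
    simp only [Finset.mul_sum, Finset.sum_mul, ← mul_assoc]
    rw [Finset.sum_comm]
  refine hF.eq_of_sum_fund_mul_eq hx hy (u := fun i => nonlinearConn F i j x y)
    (v := fun i => N i j) (fun m => ?_) i
  rw [hF.sum_fund_mul_nonlinearConn hx hy, key]
  simp only [spray, add_sub_cancel_right]

/-- Uniqueness of the Cartan connection: a symmetric metrical connection whose deflection
vanishes has the Cartan horizontal coefficients. -/
theorem cartanConn_eq_of_compatible (i j k : Fin n) : cartanConn F i j k x y = A i j k := by
  -- With the nonlinear connections identified, `hcompat` concerns the true `δₖ`, and the usual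
  -- Christoffel elimination applies.
  have hδ : ∀ i j k, hDeriv F k (fund F i j) x y =
      ∑ r, fund F r j x y * A r i k + ∑ r, fund F i r x y * A r j k := by
    intro i j k
    simp only [hDeriv, hF.nonlinearConn_eq_of_compatible hx hy hA hcompat, hcompat]
  refine hF.eq_of_sum_fund_mul_eq hx hy (u := fun i => cartanConn F i j k x y)
    (v := fun i => A i j k) (fun m => ?_) i
  rw [hF.sum_fund_mul_cartanConn hx hy]
  simp only [hδ, hF.fund_symm hx hy _ m, hF.fund_symm hx hy _ k,
    hA _ m, hA _ j k]
  ring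

end Uniqueness

end IsLocalMetric

/-! ### Horizontal constancy of `F` and of its `y`-gradient. -/

namespace IsLocalMetric

variable {U : Set (Coord n)} {F : Coord n → Coord n → ℝ} (hF : IsLocalMetric U F)
  {x y : Coord n} (hx : x ∈ U) (hy : y ≠ 0)

include hF hx hy

/-- `δₖ (Xᵢ yⁱ) = X_{i|k} yⁱ`. -/
theorem hDeriv_sum_mul_coord {X : Fin n → Coord n → Coord n → ℝ} (hX : ∀ i, SlitSmooth U (X i))
    (k : Fin n) : hDeriv F k (fun x y => ∑ i, X i x y * y i) x y =
      ∑ i, hCovDeriv F X i k x y * y i := by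
  rw [hDeriv_sum hF.isOpen hx hy _ F k (fun i => (hX i).mul (slitSmooth_coord U i))]
  simp only [fun i => hDeriv_mul hF.isOpen hx hy F k (hX i) (slitSmooth_coord U i), hDeriv_coord,
    hCovDeriv, sub_mul, Finset.sum_sub_distrib, mul_neg, ← sub_eq_add_neg]
  congr 1
  simp only [← hF.sum_cartanConn_mul_coord' hx hy, Finset.mul_sum, Finset.sum_mul, ← mul_assoc]
  rw [Finset.sum_comm]

/-- Here `∂̇ᵢE = gᵢⱼyʲ`; the metric is parallel, and `δₖyʲ = -Γʲᵣₖyʳ` cancels the remaining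
connection term. -/
theorem hCovDeriv_dy_energy (i k : Fin n) :
    hCovDeriv F (fun i => dy i (energy F)) i k x y = 0 := by
  have hs := fun j => hF.smooth.fund hF.isOpen i j
  rw [hCovDeriv, ← hDeriv_congr hF.isOpen hx hy F k (hF.smooth.energy.dy hF.isOpen i)
      fun x hx y hy => hF.sum_fund_mul_coord hx hy i,
    hDeriv_sum hF.isOpen hx hy _ F k (fun j => (hs j).mul (slitSmooth_coord U j))]
  simp only [fun j => hDeriv_mul hF.isOpen hx hy F k (hs j) (slitSmooth_coord U j), hDeriv_coord,
    hF.hDeriv_fund hx hy, ← hF.sum_fund_mul_coord hx hy, ← hF.sum_cartanConn_mul_coord' hx hy,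
    Finset.sum_add_distrib, add_mul, Finset.mul_sum, Finset.sum_mul, mul_neg,
    Finset.sum_neg_distrib]
  rw [Finset.sum_comm (f := fun j r => fund F i r x y * cartanConn F r j k x y * y j),
    Finset.sum_comm (f := fun j r => fund F r j x y * cartanConn F r i k x y * y j)]
  simp only [mul_assoc, mul_comm (y _)]
  ring

/-- By Euler `2E = yⁱ∂̇ᵢE`, a contraction of horizontally parallel objects. -/
theorem hDeriv_energy (k : Fin n) : hDeriv F k (energy F) x y = 0 := by
  have hs := fun j => hF.smooth.energy.dy hF.isOpen j
  have h1 := hF.hDeriv_sum_mul_coord hx hy hs k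
  simp only [hF.hCovDeriv_dy_energy hx hy, zero_mul, Finset.sum_const_zero] at h1
  rw [hDeriv_congr hF.isOpen hx hy F k (g := fun x y => energy F x y + energy F x y)
      (hF.smooth.energy.add hF.smooth.energy), hDeriv_add hF.isOpen hx hy F k hF.smooth.energy
      hF.smooth.energy] at h1
  · linarith
  · intro x hx y hy
    have h2 := hF.euler x hx y hy
    simp only [hF.dy_energy hx hy, mul_assoc, ← Finset.mul_sum, h2, energy]
    ring

theorem hDeriv_self (k : Fin n) : hDeriv F k F x y = 0 := by
  have h1 := hF.hDeriv_energy hx hy k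
  have h2 := hDeriv_mul hF.isOpen hx hy F k hF.smooth hF.smooth
  rw [hDeriv_congr hF.isOpen hx hy F k (g := fun x y => energy F x y + energy F x y)
    (hF.smooth.energy.add hF.smooth.energy) (fun x _ y _ => by simp only [energy]; ring),
    hDeriv_add hF.isOpen hx hy F k hF.smooth.energy hF.smooth.energy, h1] at h2
  have h3 := (hF.pos x hx y hy).ne'
  have h4 : hDeriv F k F x y * F x y = 0 := by linarith
  exact (mul_eq_zero.1 h4).resolve_right h3

theorem hCovDeriv_dy (i k : Fin n) : hCovDeriv F (fun i => dy i F) i k x y = 0 := by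
  have h1 := hF.hCovDeriv_dy_energy hx hy i k
  have hs := hF.smooth.dy hF.isOpen i
  rw [hCovDeriv, hDeriv_congr hF.isOpen hx hy F k (hF.smooth.mul hs)
    (fun x hx y hy => hF.dy_energy hx hy i), hDeriv_mul hF.isOpen hx hy F k hF.smooth hs,
    hF.hDeriv_self hx hy] at h1
  simp only [hF.dy_energy hx hy, mul_assoc, ← Finset.mul_sum, zero_mul, zero_add, ← mul_sub] at h1
  exact (mul_eq_zero.1 h1).resolve_left (hF.pos x hx y hy).ne'

/-- If two Finsler functions have the same Cartan horizontal coefficients at a point, they have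
the same nonlinear connection there. -/
theorem nonlinearConn_congr {U' : Set (Coord n)} {F' : Coord n → Coord n → ℝ}
    (hF' : IsLocalMetric U' F') (hx' : x ∈ U')
    (h : ∀ i j k, cartanConn F' i j k x y = cartanConn F i j k x y) (i j : Fin n) :
    nonlinearConn F' i j x y = nonlinearConn F i j x y := by
  simp only [← hF.sum_cartanConn_mul_coord hx hy, ← hF'.sum_cartanConn_mul_coord hx' hy, h]

end IsLocalMetric

/-! ### The `β`-conformal change in coordinates. -/

theorem hDeriv_congr_conn {F F' f : Coord n → Coord n → ℝ} {x y : Coord n}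
    (h : ∀ i j, nonlinearConn F' i j x y = nonlinearConn F i j x y) (k : Fin n) :
    hDeriv F' k f x y = hDeriv F k f x y := by
  simp only [hDeriv, h]

/-- `F̄ = e^s F + bᵢ yⁱ` is a Finsler function obtained from `F` by a `β`-conformal change, in
coordinates. -/
structure IsBetaChange (U : Set (Coord n)) (s : Coord n → ℝ) (b : Fin n → Coord n → Coord n → ℝ)
    (F F' : Coord n → Coord n → ℝ) : Prop where
  metric : IsLocalMetric U F
  metric' : IsLocalMetric U F'
  smooth_factor : ContDiffOn ℝ ∞ s U
  smooth_form : ∀ i, SlitSmooth U (b i)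
  dy_form : ∀ i j, ∀ x ∈ U, ∀ y, y ≠ 0 → dy j (b i) x y = 0
  eq : ∀ x ∈ U, ∀ y, y ≠ 0 → F' x y = Real.exp (s x) * F x y + ∑ i, b i x y * y i

namespace IsBetaChange

variable {U : Set (Coord n)} {s : Coord n → ℝ} {b : Fin n → Coord n → Coord n → ℝ}
  {F F' : Coord n → Coord n → ℝ} (h : IsBetaChange U s b F F') {x y : Coord n} (hx : x ∈ U)
  (hy : y ≠ 0)

include h

theorem smooth_exp : SlitSmooth U fun x _ => Real.exp (s x) :=
  (h.smooth_factor.comp contDiffOn_fst fun _ hp => hp.1).exp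

include hx

theorem hDeriv_exp (k : Fin n) : hDeriv F k (fun x _ => Real.exp (s x)) x y =
    Real.exp (s x) * fderiv ℝ s x (EuclideanSpace.single k 1) := by
  have hd : DifferentiableAt ℝ s x :=
    (h.smooth_factor.contDiffAt (h.metric.isOpen.mem_nhds hx)).differentiableAt (by simp)
  simp [hDeriv, dx, dy, fderiv_exp hd]

include hy

theorem hDeriv_eq (k : Fin n) : hDeriv F k F' x y =
    Real.exp (s x) * fderiv ℝ s x (EuclideanSpace.single k 1) * F x y
      + ∑ i, hCovDeriv F b i k x y * y i := by
  have hU := h.metric.isOpen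
  have hsum : SlitSmooth U fun x y => ∑ i, b i x y * y i :=
    SlitSmooth.sum fun i => (h.smooth_form i).mul (slitSmooth_coord U i)
  rw [hDeriv_congr hU hx hy F k ((h.smooth_exp.mul h.metric.smooth).add hsum) h.eq,
    hDeriv_add hU hx hy F k (h.smooth_exp.mul h.metric.smooth) hsum,
    hDeriv_mul hU hx hy F k h.smooth_exp h.metric.smooth, h.hDeriv_exp hx,
    h.metric.hDeriv_self hx hy, h.metric.hDeriv_sum_mul_coord hx hy h.smooth_form]
  ring

theorem dy_eq (i : Fin n) : dy i F' x y = Real.exp (s x) * dy i F x y + b i x y := by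
  have hU := h.metric.isOpen
  have hsum := fun i => (h.smooth_form i).mul (slitSmooth_coord U i)
  rw [dy_congr hU hx hy i ((h.smooth_exp.mul h.metric.smooth).add (SlitSmooth.sum hsum)) h.eq,
    dy_add hU hx hy i (h.smooth_exp.mul h.metric.smooth) (SlitSmooth.sum hsum),
    dy_mul hU hx hy i h.smooth_exp h.metric.smooth, dy_sum hU hx hy _ i hsum]
  simp only [fun j => dy_mul hU hx hy i (h.smooth_form j) (slitSmooth_coord U j), dy_coord,
    h.dy_form _ i x hx y hy]
  have h0 : dy i (fun x _ => Real.exp (s x)) x y = 0 := by simp [dy]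
  simp [h0]

/-- `L ḡᵢⱼ = L l̄ᵢ l̄ⱼ + e^s L̄ (gᵢⱼ - lᵢ lⱼ)`. -/
theorem mul_fund_eq (i j : Fin n) : F x y * fund F' i j x y =
    F x y * (dy i F' x y * dy j F' x y)
      + F' x y * Real.exp (s x) * (fund F i j x y - dy i F x y * dy j F x y) := by
  have hU := h.metric.isOpen
  have hs := h.metric.smooth.dy hU j
  have h0 : dy i (fun x _ => Real.exp (s x)) x y = 0 := by simp [dy]
  -- As `β` is linear in `y`, it does not contribute to the Hessian in `y`.
  have h1 : dy i (dy j F') x y = Real.exp (s x) * dy i (dy j F) x y := by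
    rw [dy_congr hU hx hy i ((h.smooth_exp.mul hs).add (h.smooth_form j))
        fun x hx y hy => h.dy_eq hx hy j,
      dy_add hU hx hy i (h.smooth_exp.mul hs) (h.smooth_form j),
      dy_mul hU hx hy i h.smooth_exp hs, h.dy_form j i x hx y hy, h0]
    ring
  rw [h.metric'.fund_eq hx hy, h.metric.fund_eq hx hy, h1]
  ring

/-- The differential of the conformal factor vanishes where `b` is parallel and the Cartan
connections agree. -/
theorem fderiv_factor_eq_zero (hb : ∀ i j, hCovDeriv F b i j x y = 0)
    (hD : ∀ i j k, cartanConn F' i j k x y = cartanConn F i j k x y) (k : Fin n) :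
    fderiv ℝ s x (EuclideanSpace.single k 1) = 0 := by
  have h1 := h.hDeriv_eq hx hy k
  -- Equal coefficients give equal `δₖ`, so `F'` is annihilated by the `δₖ` of `F` too.
  rw [← hDeriv_congr_conn (h.metric.nonlinearConn_congr hx hy h.metric' hx hD),
    h.metric'.hDeriv_self hx hy] at h1
  simpa [hb, (h.metric.pos x hx y hy).ne', (Real.exp_pos (s x)).ne'] using h1

theorem hCovDeriv_dy_eq (hs : ∀ k, fderiv ℝ s x (EuclideanSpace.single k 1) = 0) (i k : Fin n) :
    hCovDeriv F (fun i => dy i F') i k x y = hCovDeriv F b i k x y := by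
  have hU := h.metric.isOpen
  have hd := h.metric.smooth.dy hU i
  have h1 := h.metric.hCovDeriv_dy hx hy i k
  rw [hCovDeriv, sub_eq_zero] at h1
  rw [hCovDeriv, hCovDeriv, hDeriv_congr hU hx hy F k
      ((h.smooth_exp.mul hd).add (h.smooth_form i)) fun x hx y hy => h.dy_eq hx hy i,
    hDeriv_add hU hx hy F k (h.smooth_exp.mul hd) (h.smooth_form i),
    hDeriv_mul hU hx hy F k h.smooth_exp hd, h.hDeriv_exp hx, hs, h1]
  simp only [h.dy_eq hx hy, add_mul, Finset.sum_add_distrib, Finset.mul_sum, ← mul_assoc]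
  ring

/-- For a homothetic factor, `b` is parallel where the Cartan connections agree. -/
theorem hCovDeriv_form_eq_zero (hs : ∀ k, fderiv ℝ s x (EuclideanSpace.single k 1) = 0)
    (hD : ∀ i j k, cartanConn F' i j k x y = cartanConn F i j k x y) (i k : Fin n) :
    hCovDeriv F b i k x y = 0 := by
  have h1 := h.metric'.hCovDeriv_dy hx hy i k
  simp only [hCovDeriv, hD,
    hDeriv_congr_conn (h.metric.nonlinearConn_congr hx hy h.metric' hx hD)] at h1
  rw [← h.hCovDeriv_dy_eq hx hy hs]
  exact h1

/-- For a homothetic factor and a parallel `b`, the Cartan connection of `F` is metrical for the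
fundamental tensor of `F'`. -/
theorem hDeriv_fund_eq (hs : ∀ k, fderiv ℝ s x (EuclideanSpace.single k 1) = 0)
    (hb : ∀ i j, hCovDeriv F b i j x y = 0) (i j k : Fin n) :
    hDeriv F k (fund F' i j) x y = ∑ r, fund F' r j x y * cartanConn F r i k x y
      + ∑ r, fund F' i r x y * cartanConn F r j k x y := by
  have hU := h.metric.isOpen
  have hd := fun i => h.metric.smooth.dy hU i
  have hd' := fun i => h.metric'.smooth.dy hU i
  have hg := h.metric.smooth.fund hU i j
  have cov := fun i => sub_eq_zero.1 (h.metric.hCovDeriv_dy hx hy i k)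
  have cov' : ∀ i, hDeriv F k (dy i F') x y = _ := fun i =>
    sub_eq_zero.1 ((h.hCovDeriv_dy_eq hx hy hs i k).trans (hb i k))
  have hF' : hDeriv F k F' x y = 0 := by rw [h.hDeriv_eq hx hy]; simp [hb, hs]
  have he : hDeriv F k (fun x _ => Real.exp (s x)) x y = 0 := by rw [h.hDeriv_exp hx, hs, mul_zero]
  -- Apply `δₖ` to `mul_fund_eq`, kept multiplied by `F` to avoid quotients.
  have key := hDeriv_congr hU hx hy F k
    ((h.metric.smooth.mul ((hd' i).mul (hd' j))).add
      ((h.metric'.smooth.mul h.smooth_exp).mul (hg.sub ((hd i).mul (hd j)))))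
    fun x hx y hy => h.mul_fund_eq hx hy i j
  rw [hDeriv_mul hU hx hy F k h.metric.smooth (h.metric'.smooth.fund hU i j),
    hDeriv_add hU hx hy F k (h.metric.smooth.mul ((hd' i).mul (hd' j)))
      ((h.metric'.smooth.mul h.smooth_exp).mul (hg.sub ((hd i).mul (hd j)))),
    hDeriv_mul hU hx hy F k h.metric.smooth ((hd' i).mul (hd' j)),
    hDeriv_mul hU hx hy F k (hd' i) (hd' j),
    hDeriv_mul hU hx hy F k (h.metric'.smooth.mul h.smooth_exp) (hg.sub ((hd i).mul (hd j))),
    hDeriv_mul hU hx hy F k h.metric'.smooth h.smooth_exp,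
    hDeriv_sub hU hx hy F k hg ((hd i).mul (hd j)),
    hDeriv_mul hU hx hy F k (hd i) (hd j), hF', he, h.metric.hDeriv_self hx hy,
    h.metric.hDeriv_fund hx hy, cov, cov, cov', cov'] at key
  refine mul_left_cancel₀ (h.metric.pos x hx y hy).ne' ?_
  have e1 := fun r => h.mul_fund_eq hx hy r j
  have e2 := fun r => h.mul_fund_eq hx hy i r
  -- The connection terms of `ḡ` decompose by the same identity, so they match `key` term by term.
  have hr : F x y * (∑ r, fund F' r j x y * cartanConn F r i k x y
      + ∑ r, fund F' i r x y * cartanConn F r j k x y) =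
      F x y * ((∑ r, dy r F' x y * cartanConn F r i k x y) * dy j F' x y
        + dy i F' x y * ∑ r, dy r F' x y * cartanConn F r j k x y)
      + F' x y * Real.exp (s x) * (∑ r, fund F r j x y * cartanConn F r i k x y
        + ∑ r, fund F i r x y * cartanConn F r j k x y
        - ((∑ r, dy r F x y * cartanConn F r i k x y) * dy j F x y
          + dy i F x y * ∑ r, dy r F x y * cartanConn F r j k x y)) := by
    simp only [mul_add, mul_sub, Finset.mul_sum, Finset.sum_mul, ← Finset.sum_add_distrib,
      ← Finset.sum_sub_distrib]
    refine Finset.sum_congr rfl fun r _ => ?_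
    linear_combination cartanConn F r i k x y * e1 r + cartanConn F r j k x y * e2 r
  rw [hr]
  linear_combination key

/-- For a homothetic factor, the Cartan connections agree where `b` is parallel. -/
theorem cartanConn_eq (hs : ∀ k, fderiv ℝ s x (EuclideanSpace.single k 1) = 0)
    (hb : ∀ i j, hCovDeriv F b i j x y = 0) (i j k : Fin n) :
    cartanConn F' i j k x y = cartanConn F i j k x y := by
  refine h.metric'.cartanConn_eq_of_compatible hx hy (A := fun i j k => cartanConn F i j k x y)
    (h.metric.cartanConn_symm hx hy) (fun i j k => ?_) i j k
  simp only [h.metric.sum_cartanConn_mul_coord hx hy]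
  exact h.hDeriv_fund_eq hx hy hs hb i j k

end IsBetaChange

/-! ### Local expressions in a chart -/

section LocalExpr

variable {M : Type*} [TopologicalSpace M] [ChartedSpace (Coord n) M] [IsManifold (𝓡 n) ∞ M]
  {φ : OpenPartialHomeomorph M (Coord n)} (hφ : φ ∈ IsManifold.maximalAtlas (𝓡 n) ∞ M)

include hφ

/-- This map is the tangent map of `φ.symm`, read through the trivialization of the tangent bundle
of the model space. -/
theorem contMDiffOn_inducedChart_symm :
    ContMDiffOn 𝓘(ℝ, Coord n × Coord n) (𝓡 n).tangent ∞
      (fun p : Coord n × Coord n =>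
        (⟨φ.symm p.1, mfderiv (𝓡 n) (𝓡 n) φ.symm p.1 p.2⟩ : TangentBundle (𝓡 n) M))
      (φ.target ×ˢ Set.univ) := by
  have h1 := (contMDiffOn_symm_of_mem_maximalAtlas hφ).contMDiffOn_tangentMapWithin (m := ∞)
    (by simp) φ.open_target.uniqueMDiffOn
  have h2 : ContMDiff 𝓘(ℝ, Coord n × Coord n) (𝓡 n).tangent ∞
      (fun p : Coord n × Coord n => (⟨p.1, p.2⟩ : TangentBundle (𝓡 n) (Coord n))) := by
    have := contMDiff_tangentBundleModelSpaceHomeomorph_symm (I := 𝓡 n) (n := ∞)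
    rw [modelWithCornersSelf_prod]
    exact this
  have h3 := h1.comp (h2.contMDiffOn (s := φ.target ×ˢ Set.univ)) fun p hp => hp.1
  refine h3.congr fun p hp => ?_
  simp only [Function.comp, tangentMapWithin]
  rw [mfderivWithin_of_isOpen φ.open_target hp.1]

omit [IsManifold (𝓡 n) ∞ M] in
-- The derivative of `φ` is a left inverse, because `φ ∘ φ.symm` is the identity near `x`. Thus
-- nonzero `y` land in the slit bundle.
theorem mfderiv_symm_ne_zero {x y : Coord n} (hx : x ∈ φ.target) (hy : y ≠ 0) :
    mfderiv (𝓡 n) (𝓡 n) φ.symm x y ≠ 0 := by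
  have h1 : MDifferentiableAt (𝓡 n) (𝓡 n) φ.symm x :=
    (contMDiffAt_symm_of_mem_maximalAtlas hφ hx).mdifferentiableAt (by simp)
  have h2 : MDifferentiableAt (𝓡 n) (𝓡 n) φ (φ.symm x) :=
    (contMDiffAt_of_mem_maximalAtlas hφ (φ.map_target hx)).mdifferentiableAt (by simp)
  have h3 : HasMFDerivAt (𝓡 n) (𝓡 n) (φ ∘ φ.symm) x _ := h2.hasMFDerivAt.comp x h1.hasMFDerivAt
  have h4 : HasMFDerivAt (𝓡 n) (𝓡 n) (φ ∘ φ.symm) x (ContinuousLinearMap.id ℝ (Coord n)) := by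
    refine (hasMFDerivAt_id (I := 𝓡 n) x).congr_of_eventuallyEq ?_
    filter_upwards [φ.open_target.mem_nhds hx] with z hz using φ.right_inv hz
  have h5 := DFunLike.congr_fun (hasMFDerivAt_unique h3 h4) y
  intro h0
  refine hy (h5.symm.trans ?_)
  change mfderiv (𝓡 n) (𝓡 n) φ (φ.symm x) (mfderiv (𝓡 n) (𝓡 n) φ.symm x y) = 0
  rw [h0, map_zero]

theorem contDiffOn_localExpr {f : TangentBundle (𝓡 n) M → ℝ} {S : Set (TangentBundle (𝓡 n) M)}
    (hf : ContMDiffOn (𝓡 n).tangent 𝓘(ℝ, ℝ) ∞ f S) {T : Set (Coord n × Coord n)}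
    (hT : T ⊆ φ.target ×ˢ Set.univ)
    (h : ∀ p ∈ T, (⟨φ.symm p.1, mfderiv (𝓡 n) (𝓡 n) φ.symm p.1 p.2⟩ :
      TangentBundle (𝓡 n) M) ∈ S) :
    ContDiffOn ℝ ∞ (fun p : Coord n × Coord n => localExpr φ f p.1 p.2) T :=
  contMDiffOn_iff_contDiffOn.1 (hf.comp ((contMDiffOn_inducedChart_symm hφ).mono hT) h)

theorem IsFinslerMetric.isLocalMetric {L : TangentBundle (𝓡 n) M → ℝ} (hL : IsFinslerMetric L) :
    IsLocalMetric φ.target (localExpr φ L) := by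
  have hs : SlitSmooth φ.target (localExpr φ L) :=
    contDiffOn_localExpr hφ hL.smooth (fun p hp => ⟨hp.1, trivial⟩)
      fun p hp => mfderiv_symm_ne_zero hφ hp.1 hp.2
  refine ⟨φ.open_target, hs, fun x hx y hy => ?_,
    fun x hx y hy => hL.pos _ _ (mfderiv_symm_ne_zero hφ hx hy), hL.posDef φ hφ⟩
  have hd : DifferentiableAt ℝ (localExpr φ L x) y :=
    (hs.differentiableAt φ.open_target hx hy).comp y (f := fun y' => (x, y')) (by fun_prop)
  -- Euler's relation: differentiate `c ↦ L (x, c y)` at `c = 1` by the chain rule and by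
  -- homogeneity, which is needed only for `c` near `1`.
  have h1 : HasDerivAt (fun c : ℝ => c • y) y 1 := by
    simpa using (hasDerivAt_id (1 : ℝ)).smul_const y
  have h2 : HasDerivAt (fun c : ℝ => localExpr φ L x (c • y)) (fderiv ℝ (localExpr φ L x) y y) 1 :=
    HasFDerivAt.comp_hasDerivAt (1 : ℝ) (l := localExpr φ L x) (f := fun c : ℝ => c • y)
      (by simpa using hd.hasFDerivAt) h1
  have h3 : HasDerivAt (fun c : ℝ => localExpr φ L x (c • y)) (localExpr φ L x y) 1 := by
    refine HasDerivAt.congr_of_eventuallyEq (f := fun c => c * localExpr φ L x y)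
      (by simpa using (hasDerivAt_id (1 : ℝ)).mul_const (localExpr φ L x y)) ?_
    filter_upwards [lt_mem_nhds one_pos] with c hc
    refine Eq.trans ?_ (hL.homogeneous (φ.symm x) (mfderiv (𝓡 n) (𝓡 n) φ.symm x y) c hc)
    simp only [localExpr]
    congr 2
    exact map_smul (mfderiv (𝓡 n) (𝓡 n) φ.symm x) c y
  rw [sum_dy_mul_coord, h2.unique h3]

theorem slitSmooth_formComp {b : (p : M) → TangentSpace (𝓡 n) p →ₗ[ℝ] ℝ} (hb : IsSmoothForm b)
    (i : Fin n) : SlitSmooth φ.target (formComp φ b i) := by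
  have h := contDiffOn_localExpr hφ hb.contMDiffOn (S := Set.univ) subset_rfl fun _ _ => trivial
  exact h.comp (g := fun p : Coord n × Coord n => localExpr φ (formFun b) p.1 p.2)
    (f := fun p : Coord n × Coord n => (p.1, EuclideanSpace.single i (1 : ℝ)))
    (by fun_prop) fun p hp => ⟨hp.1, trivial⟩

omit [IsManifold (𝓡 n) ∞ M] hφ in
theorem localExpr_formFun (b : (p : M) → TangentSpace (𝓡 n) p →ₗ[ℝ] ℝ) (x y : Coord n) :
    localExpr φ (formFun b) x y = ∑ i, formComp φ b i x y * y i := by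
  set ℓ : Coord n →ₗ[ℝ] ℝ :=
    (b (φ.symm x)).comp (mfderiv (𝓡 n) (𝓡 n) φ.symm x : Coord n →L[ℝ] _).toLinearMap with hℓ
  change ℓ y = ∑ i, ℓ (EuclideanSpace.single i 1) * y i
  conv_lhs => rw [← (EuclideanSpace.basisFun (Fin n) ℝ).sum_repr y]
  simp [mul_comm]

theorem isBetaChange_localExpr {L : TangentBundle (𝓡 n) M → ℝ} (hL : IsFinslerMetric L)
    {σ : M → ℝ} (hσ : ContMDiff (𝓡 n) 𝓘(ℝ, ℝ) ∞ σ)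
    {b : (p : M) → TangentSpace (𝓡 n) p →ₗ[ℝ] ℝ} (hb : IsSmoothForm b)
    (hL' : IsFinslerMetric (betaConformal σ b L)) :
    IsBetaChange φ.target (fun x => σ (φ.symm x)) (formComp φ b) (localExpr φ L)
      (localExpr φ (betaConformal σ b L)) where
  metric := hL.isLocalMetric hφ
  metric' := hL'.isLocalMetric hφ
  smooth_factor := contMDiffOn_iff_contDiffOn.1
    (hσ.comp_contMDiffOn (contMDiffOn_symm_of_mem_maximalAtlas hφ))
  smooth_form := slitSmooth_formComp hφ hb
  dy_form i j x _ y _ := by simp [dy, formComp]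
  eq x _ y _ := by rw [← localExpr_formFun]; rfl

end LocalExpr

end Finsler

end

/-! ### From charts to the manifold. -/

theorem theoremB {n : ℕ} {M : Type*} [TopologicalSpace M]
    [ChartedSpace (EuclideanSpace ℝ (Fin n)) M] [IsManifold (𝓡 n) ∞ M]
    (L : TangentBundle (𝓡 n) M → ℝ) (hL : Finsler.IsFinslerMetric L)
    (σ : M → ℝ) (hσ : ContMDiff (𝓡 n) 𝓘(ℝ, ℝ) ∞ σ)
    (b : (p : M) → TangentSpace (𝓡 n) p →ₗ[ℝ] ℝ) (hb : Finsler.IsSmoothForm b)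
    (hLbar : Finsler.IsFinslerMetric (Finsler.betaConformal σ b L)) :
    ((Finsler.IsCartanParallel L b ∧
        Finsler.DifferenceVanishes L (Finsler.betaConformal σ b L)) →
      Finsler.IsHomothetic (n := n) σ) ∧
    (Finsler.IsHomothetic (n := n) σ →
      (Finsler.IsCartanParallel L b ↔
        Finsler.DifferenceVanishes L (Finsler.betaConformal σ b L))) := by
  refine ⟨fun ⟨hp, hD⟩ φ hφ x hx k => ?_, fun hs => ⟨fun hp φ hφ x hx y hy i j k => ?_,
    fun hD φ hφ x hx y hy i j => ?_⟩⟩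
  -- The conclusion involves no `y`, so one nonzero supporting element suffices; the index `k`
  -- supplies a basis vector.
  · have hy : EuclideanSpace.single k (1 : ℝ) ≠ 0 := by simp
    exact (Finsler.isBetaChange_localExpr hφ hL hσ hb hLbar).fderiv_factor_eq_zero hx hy
      (hp φ hφ x hx _ hy) (fun i j k => sub_eq_zero.1 (hD φ hφ x hx _ hy i j k)) k
  · exact sub_eq_zero.2 ((Finsler.isBetaChange_localExpr hφ hL hσ hb hLbar).cartanConn_eq hx hy
      (hs φ hφ x hx) (hp φ hφ x hx y hy) i j k)
  · exact (Finsler.isBetaChange_localExpr hφ hL hσ hb hLbar).hCovDeriv_form_eq_zero hx hy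
      (hs φ hφ x hx) (fun i j k => sub_eq_zero.1 (hD φ hφ x hx y hy i j k)) i j
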